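/- **Setting.** Let $\Psi$ be a task-motion domain. It consists of a set of states $S$, a set of actions $A$, a transition function $\gamma:S\times A\to S$, a start state $s_0$ and goal states $S_g\subseteq S$; a configuration space $C\subset\mathbb R^d$ that is bounded and convex and has nonempty interior; a Boolean collision test $f$ with $C_{free}=\{q\in C: f(q)=1\}$; a map $\varphi$ giving for each state the set of configurations that realize it; a map $\xi$ giving for each action the set of configurations admissible during it; and a start configuration $q_0$. A *solution* is a sequence of actions $a_0,\dots,a_n$ with continuous $\tau_0,\dots,\tau_n:[0,1]\to C_{free}$ such that $s_{i+1}=\gamma(s_i,a_i)$, $s_{n+1}\in S_g$, $\tau_0(0)=q_0$, $\tau_i(0)\in\varphi(s_i)$, $\tau_i(1)\in\varphi(s_{i+1})$, $\tau_{i+1}(0)=\tau_i(1)$, and $\tau_i$ takes values in $\xi(a_i)$. It *has clearance* if for some $\delta>0$ and every $i$, all points of $C$ at distance $<\delta$ from $\tau_i([0,1])$ lie in $C_{free}\cap\xi(a_i)$, and all points of $C$ at distance $<\delta$ from $\tau_i(1)$ lie in $\varphi(s_{i+1})$. (If $C_{free}$ and all $\varphi(s)$, $\xi(a)$ are open in $C$,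 every solution has clearance.) **AND/OR graph network.** Let $\Gamma=(G_0^a,G_1^a,\dots)$ be a sequence of augmented AND/OR graphs on a common finite set of nodes and hyper-arcs. Each hyper-arc leads from a set of child nodes to a parent node and carries a finite sequence of actions and a cost; each node carries a set of states that satisfy it; the augmented node (the current configuration) is satisfied by all states, is never the parent of a hyper-arc, and is the only child of each augmented hyper-arc. Some nodes that are children of no hyper-arc are labelled *success* (only goal states satisfy them) or *failure* (no node has both labels). A hyper-arc carries at least one action, except that an augmented hyper-arc not leading to a success node may carry none. A graph is entered with only its augmented node achieved. A hyper-arc is *feasible* if all its children are achieved and satisfied by the current state and its parent is not yet achieved. It is traversed by performing its actions; the traversal counts if the resulting state satisfies the parent, which then becomes achieved. Reaching a success node solves the network; reaching a failure node leads to the next graph, with the current state; a graph that still has a feasible hyper-arc may also be given up for the next one, with the current state. $\Gamma$ *contains* a sequence of actions within depth $l$ if performing these actions solves $\Gamma$ from $s_0$ in this way, starting in $G_0^a$ and using at most $l$ graphs. **Algorithm.** TMP-IDAN with depth limit $l$ and motion planning time $t$ searches $\Gamma$ with backtracking, starting in $G_0^a$ from $(s_0,q_0)$ and using at most $l$ graphs.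 In the current graph it tries the feasible hyper-arcs in order of cost; if none leads to a solution it goes on with the next graph from the current state and configuration; if there is no feasible hyper-arc this branch of the search ends. For each action $a$ of a hyper-arc, in state $s$ and configuration $q$, it runs RRT for $t$ iterations from $q$ in the free set $C_{free}\cap\xi(a)$ and tries, in order of a given cost, all motion plans found, i.e. the tree trajectories that end in $\varphi(\gamma(s,a))$, until one can be completed to a solution. In each RRT iteration a sample $x$ is drawn uniformly from $C$, the nearest tree vertex $v$ is steered straight towards $x$ by at most the step size $\eta>0$, and the new vertex and edge are added if the edge lies in the free set; the initial tree is the vertex $q$ if $q$ is in the free set, and empty otherwise. All samples, within one RRT call and across the calls, are independent. **Lemma (TMP-IDAN is probabilistically complete).** Suppose that there is a solution with clearance whose sequence of actions is contained in $\Gamma$ within some finite depth. Then $$\lim_{l,t\to\infty} P\big(\text{TMP-IDAN with depth limit } l \text{ and time } t \text{ returns a solution}\big)=1,$$ where $l$ and $t$ go to infinity jointly, and the (outer) probability that it does not return a solution tends to $0$. -/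

import Mathlib

open MeasureTheory ProbabilityTheory Filter Topology

noncomputable section

/-! ### The task-motion planning problem -/

/-- Configurations are vectors of `d` real coordinates. -/
abbrev Conf (d : ℕ) := EuclideanSpace ℝ (Fin d)

/-- A trajectory `τ : [0,1] → ℝᵈ`. -/
abbrev Traj (d : ℕ) := C(unitInterval, Conf d)

/-- A task domain: transition function, start state and goal states. -/
structure TaskDomain (S A : Type*) where
  γ : S → A → S
  s₀ : S
  goal : Set S

/-- A motion planning domain: configuration space `C`, collision test `f` (`f q` means that `q` is
free), start configuration and goal configurations. -/
structure MotionDomain (d : ℕ) where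
  C : Set (Conf d)
  f : Conf d → Prop
  q₀ : Conf d
  goal : Set (Conf d)

/-- The free configurations. -/
def MotionDomain.free {d : ℕ} (M : MotionDomain d) : Set (Conf d) := {q | q ∈ M.C ∧ M.f q}

/-- A task-motion domain: `φ s` is the set of configurations that realize the state `s`, and `ξ a`
is the set of configurations admissible during the action `a`: the motion plans for `a` are the
trajectories in `ξ a`. -/
structure TaskMotionDomain (S A : Type*) (d : ℕ) extends TaskDomain S A where
  C : Set (Conf d)
  f : Conf d → Prop
  φ : S → Set (Conf d)
  ξ : A → Set (Conf d)
  q₀ : Conf d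

/-- A task-motion plan: actions `a₀, …, aₙ` with trajectories `τ₀, …, τₙ`. -/
abbrev TMPlan (A : Type*) (d : ℕ) := List (A × Traj d)

namespace TaskMotionDomain

variable {S A : Type*} {d : ℕ}

/-- The free configurations. -/
def free (Ψ : TaskMotionDomain S A d) : Set (Conf d) := {q | q ∈ Ψ.C ∧ Ψ.f q}

/-- The state `sᵢ` reached from `s₀` by the first `i` actions of a plan. -/
def stateAt (Ψ : TaskMotionDomain S A d) (p : TMPlan A d) (i : ℕ) : S :=
  ((p.take i).map Prod.fst).foldl Ψ.γ Ψ.s₀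

/-- `p` solves the task-motion planning problem for `Ψ`. -/
structure IsSolution (Ψ : TaskMotionDomain S A d) (p : TMPlan A d) : Prop where
  ne_nil : p ≠ []
  goal : Ψ.stateAt p p.length ∈ Ψ.goal
  start : ∀ h : 0 < p.length, p[0].2 0 = Ψ.q₀
  source : ∀ (i : ℕ) (h : i < p.length), p[i].2 0 ∈ Ψ.φ (Ψ.stateAt p i)
  target : ∀ (i : ℕ) (h : i < p.length), p[i].2 1 ∈ Ψ.φ (Ψ.stateAt p (i + 1))
  glue : ∀ (i : ℕ) (h : i + 1 < p.length), p[i + 1].2 0 = p[i].2 1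
  free : ∀ (i : ℕ) (h : i < p.length) (u : unitInterval), p[i].2 u ∈ Ψ.free
  action : ∀ (i : ℕ) (h : i < p.length) (u : unitInterval), p[i].2 u ∈ Ψ.ξ p[i].1

/-- Clearance: for some `δ > 0`, all configurations of `C` at distance less than `δ` from `τᵢ` are
free and admissible for `aᵢ`, and all those at distance less than `δ` from the end point of `τᵢ`
realize the state `sᵢ₊₁`. -/
def HasClearance (Ψ : TaskMotionDomain S A d) (p : TMPlan A d) : Prop :=
  ∃ δ : ℝ, 0 < δ ∧ ∀ (i : ℕ) (h : i < p.length),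
    (∀ u : unitInterval, Metric.ball (p[i].2 u) δ ∩ Ψ.C ⊆ Ψ.free ∩ Ψ.ξ p[i].1) ∧
    Metric.ball (p[i].2 1) δ ∩ Ψ.C ⊆ Ψ.φ (Ψ.stateAt p (i + 1))

/-- The motion planning domain of the action `a`, taken in the state `s` at the configuration `q`. -/
def motionDomain (Ψ : TaskMotionDomain S A d) (s : S) (q : Conf d) (a : A) : MotionDomain d where
  C := Ψ.C
  f := fun x => Ψ.f x ∧ x ∈ Ψ.ξ a
  q₀ := q
  goal := Ψ.φ (Ψ.γ s a)

end TaskMotionDomain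

/-! ### AND/OR graph networks -/

/-- An AND/OR graph with nodes `N` and hyper-arcs `H`. -/
structure AndOrGraph (N H : Type*) where
  children : H → Finset N
  parent : H → N

/-- The augmented graph: `none` is the augmented node `nᵃ`, and `k : K` is an augmented hyper-arc
from `nᵃ` to the node `aug k`. -/
def AndOrGraph.augment {N H K : Type*} (G : AndOrGraph N H) (aug : K → N) :
    AndOrGraph (Option N) (H ⊕ K) where
  children := Sum.elim (fun h => (G.children h).map Function.Embedding.some) (fun _ => {none})
  parent := Sum.elim (fun h => some (G.parent h)) (fun k => some (aug k))

/-- An augmented AND/OR graph that models the task domain `D`: nodes carry symbolic descriptions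
(the sets of states that satisfy them), hyper-arcs carry sequences of actions and costs, and some
nodes without successors are labelled success or failure. A hyper-arc carries at least one action;
only an augmented hyper-arc that merely records a fact about the current configuration carries
none. -/
structure TaskGraph {S A : Type*} (D : TaskDomain S A) (N H K : Type*) where
  graph : AndOrGraph N H
  aug : K → N
  label : N → Set S
  acts : H ⊕ K → List A
  cost : H ⊕ K → ℝ
  success : Finset N
  failure : Finset N
  disjoint : Disjoint success failure
  success_terminal : ∀ n ∈ success, ∀ h, n ∉ graph.children h
  failure_terminal : ∀ n ∈ failure, ∀ h, n ∉ graph.children h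
  success_goal : ∀ n ∈ success, label n ⊆ D.goal
  acts_ne_nil : ∀ h : H, acts (Sum.inl h) ≠ []
  aug_acts_ne_nil : ∀ k : K, aug k ∈ success → acts (Sum.inr k) ≠ []

namespace TaskGraph

variable {S A : Type*} {D : TaskDomain S A} {N H K : Type*}

/-- The augmented AND/OR graph `Gᵃ`. -/
def augmented (G : TaskGraph D N H K) : AndOrGraph (Option N) (H ⊕ K) := G.graph.augment G.aug

/-- The states that satisfy a node of `Gᵃ`; the augmented node stands for the current
configuration, so it is always satisfied. -/
def sat (G : TaskGraph D N H K) (n : Option N) : Set S := n.elim Set.univ G.label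

/-- With the nodes `ach` achieved so far and the current state `s`, the hyper-arc `h` can be
traversed: all its children are achieved (AND), and its parent is not yet. -/
def Feasible (G : TaskGraph D N H K) (ach : Finset (Option N)) (s : S) (h : H ⊕ K) : Prop :=
  (∀ n ∈ G.augmented.children h, n ∈ ach ∧ s ∈ G.sat n) ∧ G.augmented.parent h ∉ ach

/-- The parent of `h` is a success node. -/
def IsSuccess (G : TaskGraph D N H K) (h : H ⊕ K) : Prop :=
  ∃ n ∈ G.success, G.augmented.parent h = some n

/-- The parent of `h` is a failure node. -/
def IsFailure (G : TaskGraph D N H K) (h : H ⊕ K) : Prop :=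
  ∃ n ∈ G.failure, G.augmented.parent h = some n

end TaskGraph

/-- An AND/OR graph network: the `i`-th graph is the one that is appended after `i` unsolved
graphs. -/
abbrev GraphNetwork {S A : Type*} (D : TaskDomain S A) (N H K : Type*) := ℕ → TaskGraph D N H K

/-- `Γ.SolvedBy i m ach s as`: starting in the `i`-th graph with achieved nodes `ach` and current
state `s`, the network is solved by the action sequence `as`, using at most `m` graphs counting the
`i`-th. A graph is left for the next one at a failure node, or if it is given up while it still has
a feasible hyper-arc; the next graph starts from the current state with only its augmented node
achieved. -/
inductive GraphNetwork.SolvedBy {S A : Type*} {D : TaskDomain S A} {N H K : Type*} [DecidableEq N]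
    (Γ : GraphNetwork D N H K) : ℕ → ℕ → Finset (Option N) → S → List A → Prop
  | success {i m : ℕ} {ach : Finset (Option N)} {s : S} (h : H ⊕ K) :
      (Γ i).Feasible ach s h → (Γ i).IsSuccess h →
      ((Γ i).acts h).foldl D.γ s ∈ (Γ i).sat ((Γ i).augmented.parent h) →
      SolvedBy Γ i (m + 1) ach s ((Γ i).acts h)
  | failure {i m : ℕ} {ach : Finset (Option N)} {s : S} {as : List A} (h : H ⊕ K) :
      (Γ i).Feasible ach s h → (Γ i).IsFailure h →
      ((Γ i).acts h).foldl D.γ s ∈ (Γ i).sat ((Γ i).augmented.parent h) →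
      SolvedBy Γ (i + 1) m {none} (((Γ i).acts h).foldl D.γ s) as →
      SolvedBy Γ i (m + 1) ach s ((Γ i).acts h ++ as)
  | step {i m : ℕ} {ach : Finset (Option N)} {s : S} {as : List A} (h : H ⊕ K) :
      (Γ i).Feasible ach s h → ¬ (Γ i).IsSuccess h → ¬ (Γ i).IsFailure h →
      ((Γ i).acts h).foldl D.γ s ∈ (Γ i).sat ((Γ i).augmented.parent h) →
      SolvedBy Γ i (m + 1) (insert ((Γ i).augmented.parent h) ach)
        (((Γ i).acts h).foldl D.γ s) as →
      SolvedBy Γ i (m + 1) ach s ((Γ i).acts h ++ as)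
  | retry {i m : ℕ} {ach : Finset (Option N)} {s : S} {as : List A} :
      (∃ h, (Γ i).Feasible ach s h) → SolvedBy Γ (i + 1) m {none} s as →
      SolvedBy Γ i (m + 1) ach s as

/-- The network, grown from its first graph in the start state, contains the task plan `as`
within depth `l`. -/
def GraphNetwork.ContainsPlan {S A : Type*} {D : TaskDomain S A} {N H K : Type*} [DecidableEq N]
    (Γ : GraphNetwork D N H K) (l : ℕ) (as : List A) : Prop :=
  Γ.SolvedBy 0 l {none} D.s₀ as

/-! ### The RRT motion planner -/

namespace RRT

variable {d : ℕ}

/-- A vertex of the tree, with the trajectory along the tree from the root `q` to it. -/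
structure Vertex (q : Conf d) where
  pt : Conf d
  path : Path q pt

/-- Move from `x` straight towards `y`, by at most the step size `η`. -/
def steer (η : ℝ) (x y : Conf d) : Conf d :=
  if dist x y ≤ η then y else x + (η / dist x y) • (y - x)

open Classical in
/-- One iteration: steer from the vertex nearest to the sample `x` towards `x`, and add the new
vertex and edge if the edge is free. -/
def extend (M : MotionDomain d) (η : ℝ) (T : List (Vertex M.q₀)) (x : Conf d) :
    List (Vertex M.q₀) :=
  match T.argmin (fun v => dist v.pt x) with
  | none => T
  | some v =>
    if segment ℝ v.pt (steer η v.pt x) ⊆ M.free then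
      T ++ [⟨steer η v.pt x, v.path.trans (Path.segment v.pt (steer η v.pt x))⟩]
    else T

open Classical in
/-- The tree after `t` iterations with the samples `x 0, …, x (t - 1)`. -/
def tree (M : MotionDomain d) (η : ℝ) (x : ℕ → Conf d) : ℕ → List (Vertex M.q₀)
  | 0 => if M.q₀ ∈ M.free then [⟨M.q₀, Path.refl M.q₀⟩] else []
  | t + 1 => extend M η (tree M η x t) (x t)

open Classical in
/-- The motion plans found in `t` iterations: the tree trajectories that end in a goal
configuration. -/
def plans (M : MotionDomain d) (η : ℝ) (x : ℕ → Conf d) (t : ℕ) : List (Traj d) :=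
  ((tree M η x t).filter (fun v => v.pt ∈ M.goal)).map (fun v => v.path.toContinuousMap)

end RRT

/-! ### TMP-IDAN -/

namespace TMPIDAN

variable {S A : Type*} {d : ℕ} {N H K : Type*}

/-- The list `L`, ordered by increasing cost, each element with its position. -/
def ranked {α : Type*} (cost : α → ℝ) (L : List α) : List (α × ℕ) :=
  (L.mergeSort (fun a b => decide (cost a ≤ cost b))).zipIdx

/-- Plan motions for a sequence of actions from the state `s` and the configuration `q`, then go on
with `cont`. Each action calls RRT for `t` iterations and tries the plans found, cheapest first, until
one can be completed. `w` records the choices made so far on the current branch of the search and so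
identifies the call: `X w n` is the `n`-th sample of the RRT call made at `w`. -/
def simulate (Ψ : TaskMotionDomain S A d) (mcost : Traj d → ℝ) (η : ℝ) (t : ℕ)
    (X : List ℕ → ℕ → Conf d) (cont : S → Conf d → List ℕ → Option (TMPlan A d)) :
    List A → S → Conf d → List ℕ → Option (TMPlan A d)
  | [], s, q, w => cont s q w
  | a :: as, s, q, w =>
    (ranked mcost (RRT.plans (Ψ.motionDomain s q a) η (X w) t)).findSome? fun τj =>
      (simulate Ψ mcost η t X cont as (Ψ.γ s a) (τj.1 1) (τj.2 :: w)).map ((a, τj.1) :: ·)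

open Classical in
/-- Search one graph `G`, given the nodes achieved so far: if there is no feasible hyper-arc, give
up; otherwise try the feasible hyper-arcs, cheapest first, and if none of them leads to a solution,
pass the current state and configuration to `next`, the search from the next graph of the network.
The number `k` bounds the number of further nodes of `G` that can be achieved. -/
def searchGraph [DecidableEq N] [Fintype H] [Fintype K] (Ψ : TaskMotionDomain S A d) (mcost : Traj d → ℝ) (η : ℝ)
    (t : ℕ) (X : List ℕ → ℕ → Conf d) (G : TaskGraph Ψ.toTaskDomain N H K)
    (next : S → Conf d → List ℕ → Option (TMPlan A d)) :
    ℕ → Finset (Option N) → S → Conf d → List ℕ → Option (TMPlan A d)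
  | 0, _, _, _, _ => none
  | k + 1, ach, s, q, w =>
    if ∃ h, G.Feasible ach s h then
      ((ranked G.cost (Finset.univ.filter (fun h => G.Feasible ach s h)).toList).findSome? fun hj =>
        simulate Ψ mcost η t X
          (fun s' q' w' =>
            if s' ∈ G.sat (G.augmented.parent hj.1) then
              if G.IsSuccess hj.1 then some []
              else if G.IsFailure hj.1 then next s' q' w'
              else searchGraph Ψ mcost η t X G next k (insert (G.augmented.parent hj.1) ach) s' q' w'
            else none)
          (G.acts hj.1) s q ((hj.2 + 1) :: w)).or
        (next s q (0 :: w))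
    else none

/-- Search the network from its `i`-th graph on, with `l` more graphs allowed. -/
def searchNetwork [Fintype N] [DecidableEq N] [Fintype H] [Fintype K] (Ψ : TaskMotionDomain S A d)
    (mcost : Traj d → ℝ) (η : ℝ) (t : ℕ) (X : List ℕ → ℕ → Conf d)
    (Γ : GraphNetwork Ψ.toTaskDomain N H K) :
    ℕ → ℕ → S → Conf d → List ℕ → Option (TMPlan A d)
  | 0, _ => fun _ _ _ => none
  | l + 1, i => searchGraph Ψ mcost η t X (Γ i)
      (searchNetwork Ψ mcost η t X Γ l (i + 1)) (Fintype.card N) {none}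

/-- TMP-IDAN with depth limit `l` and `t` iterations for each call of RRT, run with the samples `X`:
the plan it returns, if any. -/
def run [Fintype N] [DecidableEq N] [Fintype H] [Fintype K] (Ψ : TaskMotionDomain S A d)
    (Γ : GraphNetwork Ψ.toTaskDomain N H K) (mcost : Traj d → ℝ) (η : ℝ)
    (X : List ℕ → ℕ → Conf d) (l t : ℕ) : Option (TMPlan A d) :=
  searchNetwork Ψ mcost η t X Γ l 0 Ψ.s₀ Ψ.q₀ []

/-- The run returns a solution of the task-motion planning problem. -/
def Finds [Fintype N] [DecidableEq N] [Fintype H] [Fintype K] (Ψ : TaskMotionDomain S A d)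
    (Γ : GraphNetwork Ψ.toTaskDomain N H K) (mcost : Traj d → ℝ) (η : ℝ)
    (X : List ℕ → ℕ → Conf d) (l t : ℕ) : Prop :=
  ∃ p, run Ψ Γ mcost η X l t = some p ∧ Ψ.IsSolution p

end TMPIDAN

end

noncomputable section

/-! ### Deterministic behaviour of the RRT tree -/

namespace RRT

variable {d : ℕ}

/-! The argument has a deterministic half and a probabilistic half. Choose `r` small against the
step size `η` and the clearance `δ`, and cut every trajectory of the given solution into `m` pieces
so that consecutive way points are at most `r` apart. If the samples of one RRT call, cut into `m`
consecutive blocks, hit in block `k` the `r`-ball around way point `k + 1`, the tree moves from way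
point to way point and ends within `r` of the last one (`RRT.exists_mem_tree_of_visits`). The next
call then starts within `r` of the next trajectory, so errors do not accumulate along the plan
(`robust_of_clearance`).

The configurations and branches met by the search are themselves random. To avoid conditioning on
them, call a sample sequence good if it visits the way points of all trajectories of the solution;
this does not depend on where or for which action it is used. If the samples are good at every word
of length at most `n` with letters at most `t + B`, with `B` the number of hyper-arcs, some branch
follows the solution and the search returns something (`exists_run_isSome`). Here `n` depends only
on how the network contains the plan, not on `t` or `l`. An earlier branch may answer first, but by
`run_sound` every answer is a solution.

There are polynomially many such words in `t`, and each is bad with probability at most a constant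
times `ρ ^ (t / m)` with `ρ < 1`. The union bound tends to `0`, uniformly in all sufficiently large
`l`. -/

theorem steer_of_dist_le {η : ℝ} {x y : Conf d} (h : dist x y ≤ η) : steer η x y = y := if_pos h

theorem subset_extend (M : MotionDomain d) (η : ℝ) (T : List (Vertex M.q₀)) (x : Conf d) :
    T ⊆ extend M η T x := by
  unfold extend
  split
  · exact List.Subset.refl T
  · split_ifs
    · exact List.subset_append_left _ _
    · exact List.Subset.refl T

theorem length_extend_le (M : MotionDomain d) (η : ℝ) (T : List (Vertex M.q₀)) (x : Conf d) :
    (extend M η T x).length ≤ T.length + 1 := by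
  unfold extend
  split
  · omega
  · split_ifs <;> simp

theorem tree_subset_tree (M : MotionDomain d) (η : ℝ) (x : ℕ → Conf d) {t t' : ℕ} (h : t ≤ t') :
    tree M η x t ⊆ tree M η x t' := by
  induction h with
  | refl => exact List.Subset.refl _
  | step _ ih => exact List.Subset.trans ih (subset_extend _ _ _ _)

theorem length_tree_le (M : MotionDomain d) (η : ℝ) (x : ℕ → Conf d) (t : ℕ) :
    (tree M η x t).length ≤ t + 1 := by
  induction t with
  | zero => unfold tree; split_ifs <;> simp
  | succ t ih => exact (length_extend_le _ _ _ _).trans (by omega)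

/-- The trajectories of the tree are free. -/
theorem path_mem_free (M : MotionDomain d) (η : ℝ) (x : ℕ → Conf d) (t : ℕ) :
    ∀ v ∈ tree M η x t, ∀ u, v.path u ∈ M.free := by
  induction t with
  | zero =>
    unfold tree
    split_ifs with h <;> simp [h]
  | succ t ih =>
    intro v hv u
    simp only [tree, extend] at hv
    split at hv
    · exact ih v hv u
    · rename_i v' hv'
      split_ifs at hv with hseg
      · rcases List.mem_append.1 hv with hv | hv
        · exact ih v hv u
        · obtain rfl := List.mem_singleton.1 hv
          have hu := Set.mem_range_self (f := v'.path.trans (Path.segment v'.pt (steer η v'.pt (x t)))) u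
          rw [Path.trans_range, Path.range_segment] at hu
          rcases hu with ⟨u', hu'⟩ | hu
          · rw [← hu']
            exact ih v' (List.argmin_mem hv') u'
          · exact hseg hu
      · exact ih v hv u

theorem pt_mem_free {M : MotionDomain d} {η : ℝ} {x : ℕ → Conf d} {t : ℕ} {v : Vertex M.q₀}
    (hv : v ∈ tree M η x t) : v.pt ∈ M.free := by
  simpa using path_mem_free M η x t v hv 1

theorem length_plans_le (M : MotionDomain d) (η : ℝ) (x : ℕ → Conf d) (t : ℕ) :
    (plans M η x t).length ≤ t + 1 := by
  unfold plans
  rw [List.length_map]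
  exact (List.length_filter_le _ _).trans (length_tree_le M η x t)

theorem plans_sound {M : MotionDomain d} {η : ℝ} {x : ℕ → Conf d} {t : ℕ} {τ : Traj d}
    (hτ : τ ∈ plans M η x t) : τ 0 = M.q₀ ∧ τ 1 ∈ M.goal ∧ ∀ u, τ u ∈ M.free := by
  unfold plans at hτ
  obtain ⟨v, hv, rfl⟩ := List.mem_map.1 hτ
  obtain ⟨hv, hg⟩ := List.mem_filter.1 hv
  refine ⟨v.path.source, ?_, path_mem_free M η x t v hv⟩
  have : v.path.toContinuousMap 1 = v.pt := v.path.target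
  rw [this]
  simpa using hg

theorem exists_mem_plans {M : MotionDomain d} {η : ℝ} {x : ℕ → Conf d} {t : ℕ} {v : Vertex M.q₀}
    (hv : v ∈ tree M η x t) (hg : v.pt ∈ M.goal) : ∃ τ ∈ plans M η x t, τ 1 = v.pt :=
  ⟨v.path.toContinuousMap, List.mem_map_of_mem (List.mem_filter.2 ⟨hv, by simpa using hg⟩),
    v.path.target⟩

/-- If some vertex is near the sample and everything near the sample is free, then the sample
becomes a vertex. -/
theorem exists_mem_extend {M : MotionDomain d} (hC : Convex ℝ M.C) {η ρ : ℝ} (hρ : ρ ≤ η)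
    {T : List (Vertex M.q₀)} (hT : ∀ u ∈ T, u.pt ∈ M.C) {v : Vertex M.q₀} (hv : v ∈ T)
    {x : Conf d} (hx : x ∈ M.C) (hvx : dist v.pt x ≤ ρ)
    (hfree : Metric.closedBall x ρ ∩ M.C ⊆ M.free) :
    ∃ u ∈ extend M η T x, u.pt = x := by
  unfold extend
  split
  · rename_i h
    rw [List.argmin_eq_none] at h
    simp [h] at hv
  · rename_i u hu
    -- The vertex chosen by RRT need not be `v`, but it is no farther from the sample, so steering
    -- reaches the sample exactly.
    have hux : dist u.pt x ≤ ρ :=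
      (List.le_of_mem_argmin (f := fun v : Vertex M.q₀ => dist v.pt x) hv hu).trans hvx
    have hst : steer η u.pt x = x := steer_of_dist_le (hux.trans hρ)
    have hseg : segment ℝ u.pt (steer η u.pt x) ⊆ M.free := by
      rw [hst]
      refine fun y hy => hfree ⟨?_, hC.segment_subset (hT u (List.argmin_mem hu)) hx hy⟩
      exact (convex_closedBall x ρ).segment_subset (Metric.mem_closedBall.2 hux)
        (Metric.mem_closedBall_self (dist_nonneg.trans hux)) hy
    rw [if_pos hseg]
    exact ⟨_, List.mem_append_right _ (List.mem_singleton_self _), hst⟩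

/-- The samples `x`, cut into blocks of length `s`, visit the sets `U 0, …, U (m - 1)` one after the
other. -/
def Visits (U : ℕ → Set (Conf d)) (m s : ℕ) (x : ℕ → Conf d) : Prop :=
  ∀ k < m, ∃ i ∈ Finset.Ico (k * s) ((k + 1) * s), x i ∈ U k

/-- Samples that visit neighborhoods of way points `c 1, …, c m` lead the tree from a root near
`c 0` to a vertex near `c m`. -/
theorem exists_mem_tree_of_visits {M : MotionDomain d} (hC : Convex ℝ M.C) {η r δ : ℝ}
    (hrη : 3 * r ≤ η) (hrδ : 4 * r < δ) {c : ℕ → Conf d} {m s t : ℕ} (hst : m * s ≤ t)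
    (hc : ∀ k < m, dist (c k) (c (k + 1)) ≤ r)
    (hfree : ∀ k ≤ m, Metric.ball (c k) δ ∩ M.C ⊆ M.free) (hr : 0 < r)
    (hq : M.q₀ ∈ M.C) (hq₀ : dist M.q₀ (c 0) < r) {x : ℕ → Conf d}
    (hx : Visits (fun k => Metric.ball (c (k + 1)) r ∩ interior M.C) m s x) :
    ∃ v ∈ tree M η x t, dist v.pt (c m) < r := by
  have key : ∀ k ≤ m, ∃ v ∈ tree M η x (k * s), dist v.pt (c k) < r := by
    intro k
    induction k with
    | zero =>
      intro _
      have h0 : M.q₀ ∈ M.free :=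
        hfree 0 (Nat.zero_le m) ⟨Metric.mem_ball.2 (by linarith), hq⟩
      refine ⟨⟨M.q₀, Path.refl M.q₀⟩, ?_, hq₀⟩
      simp [tree, h0]
    | succ k ih =>
      intro hk
      obtain ⟨v, hv, hvk⟩ := ih (by omega)
      obtain ⟨i, hi, hxi, hxC⟩ := hx k (by omega)
      rw [Finset.mem_Ico] at hi
      rw [Metric.mem_ball] at hxi
      -- One `r` from the vertex to `c k`, one to `c (k + 1)`, one to the sample. A point within `3
      -- * r` of the sample is then within `4 * r < δ` of `c (k + 1)`, hence free.
      have hvx : dist v.pt (x i) ≤ 3 * r := by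
        have h1 := dist_triangle4 v.pt (c k) (c (k + 1)) (x i)
        have h2 := hc k (by omega)
        rw [dist_comm (c (k + 1))] at h1
        linarith
      obtain ⟨u, hu, hux⟩ := exists_mem_extend hC hrη (T := tree M η x i)
        (fun u hu => (pt_mem_free hu).1) (tree_subset_tree M η x hi.1 hv) (interior_subset hxC) hvx
        (fun y hy => hfree (k + 1) hk ⟨by
          have h1 := dist_triangle y (x i) (c (k + 1))
          have h2 := Metric.mem_closedBall.1 hy.1
          exact Metric.mem_ball.2 (by linarith), hy.2⟩)
      exact ⟨u, tree_subset_tree M η x (t := i + 1) hi.2 hu, by rwa [hux]⟩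
  obtain ⟨v, hv, hvm⟩ := key m le_rfl
  exact ⟨v, tree_subset_tree M η x hst hv, hvm⟩

end RRT

/-! ### Recursive form of being a solution -/

namespace TaskMotionDomain

variable {S A : Type*} {d : ℕ}

/-- `Ψ.Completes s q p`: the plan `p` is valid from the state `s` and the configuration `q`, and ends
in a goal state. -/
def Completes (Ψ : TaskMotionDomain S A d) : S → Conf d → TMPlan A d → Prop
  | s, _, [] => s ∈ Ψ.goal
  | s, q, (a, τ) :: p => τ 0 = q ∧ (∀ u, τ u ∈ Ψ.free ∧ τ u ∈ Ψ.ξ a) ∧ τ 1 ∈ Ψ.φ (Ψ.γ s a) ∧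
      Completes Ψ (Ψ.γ s a) (τ 1) p

/-- Changing the start of a domain. -/
def startAt (Ψ : TaskMotionDomain S A d) (s : S) (q : Conf d) : TaskMotionDomain S A d :=
  { Ψ with s₀ := s, q₀ := q }

/-- The search builds plans from the head, so validity is handled recursively. Moving the start to
the first reached state and configuration makes the indexed conditions on the tail agree
definitionally with the shifted conditions on the whole plan. -/
theorem Completes.isSolution_startAt (Ψ : TaskMotionDomain S A d) (p : TMPlan A d) (hp : p ≠ []) :
    ∀ (s : S) (q : Conf d), q ∈ Ψ.φ s → Ψ.Completes s q p → (Ψ.startAt s q).IsSolution p := by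
  induction p with
  | nil => exact absurd rfl hp
  | cons aτ p ih =>
    obtain ⟨a, τ⟩ := aτ
    rintro s q hq ⟨h0, hfree, h1, hrest⟩
    rcases eq_or_ne p [] with rfl | hne
    · refine ⟨hp, hrest, fun _ => h0, ?_, ?_, ?_, ?_, ?_⟩
      · intro i h
        obtain rfl : i = 0 := by simpa using h
        exact (h0 ▸ hq : τ 0 ∈ Ψ.φ s)
      · intro i h
        obtain rfl : i = 0 := by simpa using h
        exact h1
      · intro i h
        simp at h
      · intro i h
        obtain rfl : i = 0 := by simpa using h
        exact fun u => (hfree u).1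
      · intro i h
        obtain rfl : i = 0 := by simpa using h
        exact fun u => (hfree u).2
    · have hs := ih hne _ _ h1 hrest
      refine ⟨hp, hs.goal, fun _ => h0, ?_, ?_, ?_, ?_, ?_⟩
      · rintro (_ | i) h
        · exact (h0 ▸ hq : τ 0 ∈ Ψ.φ s)
        · exact hs.source i (Nat.lt_of_succ_lt_succ h)
      · rintro (_ | i) h
        · exact h1
        · exact hs.target i (Nat.lt_of_succ_lt_succ h)
      · rintro (_ | i) h
        · exact hs.start (Nat.lt_of_succ_lt_succ h)
        · exact hs.glue i (Nat.lt_of_succ_lt_succ h)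
      · rintro (_ | i) h
        · exact fun u => (hfree u).1
        · exact hs.free i (Nat.lt_of_succ_lt_succ h)
      · rintro (_ | i) h
        · exact fun u => (hfree u).2
        · exact hs.action i (Nat.lt_of_succ_lt_succ h)

end TaskMotionDomain

namespace TMPIDAN

variable {S A : Type*} {d : ℕ} {N H K : Type*}

theorem mem_of_mem_ranked {α : Type*} {cost : α → ℝ} {L : List α} {x : α × ℕ}
    (hx : x ∈ ranked cost L) : x.1 ∈ L :=
  List.mem_mergeSort.1 (List.fst_mem_of_mem_zipIdx hx)

theorem exists_mem_ranked {α : Type*} (cost : α → ℝ) {L : List α} {x : α} (hx : x ∈ L) :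
    ∃ j < L.length, (x, j) ∈ ranked cost L := by
  obtain ⟨j, hj, rfl⟩ := List.mem_iff_getElem.1
    (List.mem_mergeSort (le := fun a b => decide (cost a ≤ cost b)).2 hx)
  exact ⟨j, by simpa using hj, List.mk_mem_zipIdx_iff_getElem?.2 (List.getElem?_eq_getElem hj)⟩

/-! ### Soundness of the search -/

/-- The second conclusion serves to exclude the empty plan, which is not a solution: an empty result
can only come from an arc without actions whose continuation also returned the empty plan. -/
theorem simulate_sound (Ψ : TaskMotionDomain S A d) (mcost : Traj d → ℝ) (η : ℝ) (t : ℕ)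
    (X : List ℕ → ℕ → Conf d) (cont : S → Conf d → List ℕ → Option (TMPlan A d)) (as : List A) :
    ∀ (s : S) (q : Conf d) (w : List ℕ) (p : TMPlan A d),
      (∀ q' w' p', cont (as.foldl Ψ.γ s) q' w' = some p' →
        Ψ.Completes (as.foldl Ψ.γ s) q' p') →
      simulate Ψ mcost η t X cont as s q w = some p →
      Ψ.Completes s q p ∧ (p = [] → as = [] ∧ cont s q w = some []) := by
  induction as with
  | nil =>
    intro s q w p hcont hp
    exact ⟨hcont q w p hp, fun h => ⟨rfl, h ▸ hp⟩⟩
  | cons a as ih =>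
    intro s q w p hcont hp
    rw [simulate] at hp
    obtain ⟨τj, hτj, hp⟩ := List.exists_of_findSome?_eq_some hp
    obtain ⟨p', hp', rfl⟩ := Option.map_eq_some_iff.1 hp
    obtain ⟨h0, h1, hfree⟩ := RRT.plans_sound (mem_of_mem_ranked hτj)
    exact ⟨⟨h0, fun u => ⟨⟨(hfree u).1, (hfree u).2.1⟩, (hfree u).2.2⟩, h1,
      (ih _ _ _ _ hcont hp').1⟩, fun h => absurd h (List.cons_ne_nil _ _)⟩

theorem _root_.TaskGraph.acts_ne_nil_of_isSuccess {D : TaskDomain S A} (G : TaskGraph D N H K)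
    {h : H ⊕ K} (hs : G.IsSuccess h) : G.acts h ≠ [] := by
  obtain ⟨n, hn, hp⟩ := hs
  rcases h with h | k
  · exact G.acts_ne_nil h
  · have : G.aug k = n := Option.some.inj hp
    exact G.aug_acts_ne_nil k (this ▸ hn)

theorem _root_.TaskGraph.mem_goal_of_isSuccess {D : TaskDomain S A} (G : TaskGraph D N H K)
    {h : H ⊕ K} (hs : G.IsSuccess h) {s : S} (hsat : s ∈ G.sat (G.augmented.parent h)) :
    s ∈ D.goal := by
  obtain ⟨n, hn, hp⟩ := hs
  rw [hp] at hsat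
  exact G.success_goal n hn hsat

theorem _root_.TaskGraph.not_isSuccess_of_isFailure {D : TaskDomain S A} (G : TaskGraph D N H K)
    {h : H ⊕ K} (hf : G.IsFailure h) : ¬ G.IsSuccess h := by
  rintro ⟨n, hn, hp⟩
  obtain ⟨n', hn', hp'⟩ := hf
  obtain rfl : n = n' := Option.some.inj (hp.symm.trans hp')
  exact Finset.disjoint_left.1 G.disjoint hn hn'

theorem searchGraph_sound [DecidableEq N] [Fintype H] [Fintype K] (Ψ : TaskMotionDomain S A d)
    (mcost : Traj d → ℝ) (η : ℝ) (t : ℕ) (X : List ℕ → ℕ → Conf d)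
    (G : TaskGraph Ψ.toTaskDomain N H K) (next : S → Conf d → List ℕ → Option (TMPlan A d))
    (hnext : ∀ s q w p, next s q w = some p → Ψ.Completes s q p ∧ p ≠ []) (k : ℕ) :
    ∀ ach s q w p, searchGraph Ψ mcost η t X G next k ach s q w = some p →
      Ψ.Completes s q p ∧ p ≠ [] := by
  induction k with
  | zero =>
    intro ach s q w p hp
    simp [searchGraph] at hp
  | succ k ih =>
    intro ach s q w p hp
    rw [searchGraph] at hp
    split_ifs at hp with hex
    rcases Option.or_eq_some_iff.1 hp with hp | ⟨_, hp⟩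
    · obtain ⟨hj, _, hp⟩ := List.exists_of_findSome?_eq_some hp
      have hsim := simulate_sound Ψ mcost η t X _ _ _ _ _ _ ?_ hp
      · refine ⟨hsim.1, fun hnil => ?_⟩
        obtain ⟨has, hc⟩ := hsim.2 hnil
        split_ifs at hc with hsat hsucc hfail
        -- Only a success arc returns the empty plan from its continuation, and such an arc carries
        -- an action.
        · exact G.acts_ne_nil_of_isSuccess hsucc has
        · exact (hnext _ _ _ _ hc).2 rfl
        · exact (ih _ _ _ _ _ hc).2 rfl
      · intro q' w' p' hc
        split_ifs at hc with hsat hsucc hfail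
        · obtain rfl := Option.some.inj hc
          exact G.mem_goal_of_isSuccess hsucc hsat
        · exact (hnext _ _ _ _ hc).1
        · exact (ih _ _ _ _ _ hc).1
    · exact hnext _ _ _ _ hp

theorem searchNetwork_sound [Fintype N] [DecidableEq N] [Fintype H] [Fintype K]
    (Ψ : TaskMotionDomain S A d) (mcost : Traj d → ℝ) (η : ℝ) (t : ℕ) (X : List ℕ → ℕ → Conf d)
    (Γ : GraphNetwork Ψ.toTaskDomain N H K) (l : ℕ) :
    ∀ i s q w p, searchNetwork Ψ mcost η t X Γ l i s q w = some p →
      Ψ.Completes s q p ∧ p ≠ [] := by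
  induction l with
  | zero =>
    intro i s q w p hp
    simp [searchNetwork] at hp
  | succ l ih =>
    intro i s q w p hp
    exact searchGraph_sound Ψ mcost η t X (Γ i) _ (ih (i + 1)) _ _ _ _ _ _ hp

theorem run_sound [Fintype N] [DecidableEq N] [Fintype H] [Fintype K]
    (Ψ : TaskMotionDomain S A d) (Γ : GraphNetwork Ψ.toTaskDomain N H K) (mcost : Traj d → ℝ)
    (η : ℝ) (X : List ℕ → ℕ → Conf d) (l t : ℕ) (hq : Ψ.q₀ ∈ Ψ.φ Ψ.s₀) {p : TMPlan A d}
    (hp : run Ψ Γ mcost η X l t = some p) : Ψ.IsSolution p :=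
  have h := searchNetwork_sound Ψ mcost η t X Γ l _ _ _ _ _ hp
  TaskMotionDomain.Completes.isSolution_startAt Ψ p h.2 _ _ hq h.1

/-! ### Completeness of the search -/

/-- `Robust Ψ η t good s R p`: whenever the samples are good, RRT leads from every configuration of
the region `R` through the successive regions of `p` by the actions of `p`. -/
def Robust (Ψ : TaskMotionDomain S A d) (η : ℝ) (t : ℕ) (good : (ℕ → Conf d) → Prop) :
    S → Set (Conf d) → List (A × Set (Conf d)) → Prop
  | _, _, [] => True
  | s, R, (a, R') :: p =>
    (∀ q ∈ R, ∀ x, good x → ∃ τ ∈ RRT.plans (Ψ.motionDomain s q a) η x t, τ 1 ∈ R') ∧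
      Robust Ψ η t good (Ψ.γ s a) R' p

/-- The calls made at most `n` choices after `w`, each choice being at most `b`, have good
samples. -/
def GoodFrom (good : (ℕ → Conf d) → Prop) (X : List ℕ → ℕ → Conf d) (b n : ℕ) (w : List ℕ) : Prop :=
  ∀ u : List ℕ, u.length ≤ n → (∀ j ∈ u, j ≤ b) → good (X (u ++ w))

theorem GoodFrom.cons {good : (ℕ → Conf d) → Prop} {X : List ℕ → ℕ → Conf d} {b n : ℕ} {w : List ℕ}
    (h : GoodFrom good X b (n + 1) w) {j : ℕ} (hj : j ≤ b) : GoodFrom good X b n (j :: w) := by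
  intro u hu hub
  have := h (u ++ [j]) (by simpa using hu) (by
    intro i hi
    rcases List.mem_append.1 hi with hi | hi
    · exact hub i hi
    · rwa [List.mem_singleton.1 hi])
  simpa using this

/-- It suffices that one motion plan in the ranked list can be completed: a plan tried earlier
either fails or already yields a result. Each action uses up one letter of the word, a position in a
list of at most `t + 1` plans. -/
theorem simulate_isSome (Ψ : TaskMotionDomain S A d) (mcost : Traj d → ℝ) (η : ℝ) {t b : ℕ}
    (htb : t ≤ b) {good : (ℕ → Conf d) → Prop} (X : List ℕ → ℕ → Conf d)
    (cont : S → Conf d → List ℕ → Option (TMPlan A d)) (p₂ : List (A × Set (Conf d))) (n : ℕ)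
    (p₁ : List (A × Set (Conf d))) :
    ∀ (s : S) (R : Set (Conf d)) (q : Conf d) (w : List ℕ), Robust Ψ η t good s R (p₁ ++ p₂) →
      q ∈ R → GoodFrom good X b (p₁.length + n) w →
      (∀ R' q' w', Robust Ψ η t good ((p₁.map Prod.fst).foldl Ψ.γ s) R' p₂ → q' ∈ R' →
        GoodFrom good X b n w' → (cont ((p₁.map Prod.fst).foldl Ψ.γ s) q' w').isSome) →
      (simulate Ψ mcost η t X cont (p₁.map Prod.fst) s q w).isSome := by
  induction p₁ with
  | nil =>
    intro s R q w hR hq hw hcont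
    exact hcont R q w hR hq (by simpa using hw)
  | cons aR p₁ ih =>
    obtain ⟨a, R'⟩ := aR
    rintro s R q w ⟨hR, hrest⟩ hq hw hcont
    obtain ⟨τ, hτ, hτR⟩ := hR q hq (X w) (hw [] (Nat.zero_le _) (by simp))
    obtain ⟨j, hj, hmem⟩ := exists_mem_ranked mcost hτ
    have hjt : j ≤ b := by
      have := RRT.length_plans_le (Ψ.motionDomain s q a) η (X w) t
      omega
    simp only [List.map_cons, simulate]
    rw [List.findSome?_isSome_iff]
    refine ⟨(τ, j), hmem, ?_⟩
    rw [Option.isSome_map]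
    refine ih _ R' _ _ hrest hτR (GoodFrom.cons ?_ hjt) hcont
    rwa [List.length_cons, Nat.add_right_comm] at hw

/-- If the network is solved by an action sequence that RRT can follow robustly, then the search
succeeds, provided that the samples are good for all calls up to some bounded number of choices. -/
theorem exists_searchGraph_isSome [Fintype N] [DecidableEq N] [Fintype H] [Fintype K]
    (Ψ : TaskMotionDomain S A d) (mcost : Traj d → ℝ) (η : ℝ)
    (Γ : GraphNetwork Ψ.toTaskDomain N H K) {i m : ℕ} {ach : Finset (Option N)} {s : S}
    {as : List A} (hs : Γ.SolvedBy i m ach s as) :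
    ∃ n, ∀ (t b : ℕ) (good : (ℕ → Conf d) → Prop) (X : List ℕ → ℕ → Conf d), t ≤ b →
      Fintype.card (H ⊕ K) ≤ b → ∀ (p : List (A × Set (Conf d))) (R : Set (Conf d)),
      p.map Prod.fst = as → Robust Ψ η t good s R p → ∀ l k, m ≤ l + 1 →
      Fintype.card N + 1 ≤ k + ach.card → ∀ q ∈ R, ∀ w, GoodFrom good X b n w →
      (searchGraph Ψ mcost η t X (Γ i) (searchNetwork Ψ mcost η t X Γ l (i + 1)) k ach s q w).isSome := by
  classical
  -- The counter `k` never runs out early: the parent of a feasible arc is not yet achieved, so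
  -- fewer than `card N + 1` nodes of the augmented graph are, and the invariant forces `k` to be
  -- positive.
  have hk : ∀ {i : ℕ} {ach : Finset (Option N)} {s : S} {h : H ⊕ K} {k : ℕ},
      (Γ i).Feasible ach s h → Fintype.card N + 1 ≤ k + ach.card → ∃ k', k = k' + 1 := by
    intro i ach s h k hf hk
    have h1 : ach.card < Fintype.card (Option N) := by
      rw [← Finset.card_univ]
      exact Finset.card_lt_card (Finset.ssubset_univ_iff.2 fun hu => hf.2 (hu ▸ Finset.mem_univ _))
    rw [Fintype.card_option] at h1
    exact ⟨k - 1, by omega⟩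
  have hnet : ∀ {i m : ℕ} {ach : Finset (Option N)} {s : S} {as : List A},
      Γ.SolvedBy i m ach s as → 1 ≤ m := by
    rintro i m ach s as (_ | _ | _ | _) <;> omega
  -- Common part of the three cases that traverse an arc. The `+ 1` in the word length pays for the
  -- choice of the arc, recorded as `j + 1` because the letter `0` stands for passing to the next
  -- graph.
  have harc : ∀ {i : ℕ} {ach : Finset (Option N)} {s : S} {h : H ⊕ K} (_ : (Γ i).Feasible ach s h)
      {t b : ℕ} {good : (ℕ → Conf d) → Prop} {X : List ℕ → ℕ → Conf d} (_ : t ≤ b)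
      (_ : Fintype.card (H ⊕ K) ≤ b) (p₁ p₂ : List (A × Set (Conf d))) (R : Set (Conf d))
      (_ : p₁.map Prod.fst = (Γ i).acts h) (_ : Robust Ψ η t good s R (p₁ ++ p₂)) (n : ℕ) {k : ℕ}
      (next : S → Conf d → List ℕ → Option (TMPlan A d)) {q : Conf d} (_ : q ∈ R) {w : List ℕ}
      (_ : GoodFrom good X b (((Γ i).acts h).length + n + 1) w)
      (_ : ((Γ i).acts h).foldl Ψ.γ s ∈ (Γ i).sat ((Γ i).augmented.parent h))
      (_ : ∀ R' q' w', Robust Ψ η t good (((Γ i).acts h).foldl Ψ.γ s) R' p₂ → q' ∈ R' →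
        GoodFrom good X b n w' →
        (if (Γ i).IsSuccess h then some []
          else if (Γ i).IsFailure h then next (((Γ i).acts h).foldl Ψ.γ s) q' w'
          else searchGraph Ψ mcost η t X (Γ i) next k (insert ((Γ i).augmented.parent h) ach)
            (((Γ i).acts h).foldl Ψ.γ s) q' w').isSome),
      (searchGraph Ψ mcost η t X (Γ i) next (k + 1) ach s q w).isSome := by
    intro i ach s h hf t b good X htb hcb p₁ p₂ R hp₁ hR n k next q hq w hw hsat hcont
    rw [searchGraph, if_pos ⟨h, hf⟩, Option.isSome_or, Bool.or_eq_true]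
    left
    have hmem : h ∈ (Finset.univ.filter (fun h => (Γ i).Feasible ach s h)).toList := by simpa using hf
    obtain ⟨j, hj, hjm⟩ := exists_mem_ranked (Γ i).cost hmem
    rw [List.findSome?_isSome_iff]
    refine ⟨(h, j), hjm, ?_⟩
    have hjb : j + 1 ≤ b := by
      rw [Finset.length_toList] at hj
      have := Finset.card_filter_le Finset.univ (fun h => (Γ i).Feasible ach s h)
      rw [Finset.card_univ] at this
      omega
    have hlen : ((Γ i).acts h).length = p₁.length := by rw [← hp₁, List.length_map]
    rw [hlen] at hw
    dsimp only
    have hw' := hw.cons hjb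
    rw [← hp₁] at hcont hsat ⊢
    refine simulate_isSome Ψ mcost η htb X _ p₂ n p₁ s R q _ hR hq hw' ?_
    intro R' q' w' h1 h2 h3
    rw [if_pos hsat]
    exact hcont R' q' w' h1 h2 h3
  induction hs with
  | @success i m ach s h hf hsucc hsat =>
    refine ⟨((Γ i).acts h).length + 0 + 1, ?_⟩
    intro t b good X htb hcb p R hp hR l k hml hkc q hq w hw
    obtain ⟨k, rfl⟩ := hk hf hkc
    refine harc hf htb hcb p [] R hp (by simpa using hR) 0 _ hq hw hsat ?_
    intro _ _ _ _ _ _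
    rw [if_pos hsucc]
    rfl
  | @failure i m ach s as h hf hfail hsat hrest ih =>
    obtain ⟨n, ih⟩ := ih
    refine ⟨((Γ i).acts h).length + n + 1, ?_⟩
    intro t b good X htb hcb p R hp hR l k hml hkc q hq w hw
    obtain ⟨k, rfl⟩ := hk hf hkc
    obtain ⟨p₁, p₂, rfl, hp₁, hp₂⟩ := List.map_eq_append_iff.1 hp
    refine harc hf htb hcb p₁ p₂ R hp₁ hR n _ hq hw hsat ?_
    intro R' q' w' hR' hq' hw'
    rw [if_neg ((Γ i).not_isSuccess_of_isFailure hfail), if_pos hfail]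
    have := hnet hrest
    obtain ⟨l, rfl⟩ : ∃ l', l = l' + 1 := ⟨l - 1, by omega⟩
    exact ih t b good X htb hcb p₂ R' hp₂ hR' l _ (by omega) (by simp) q' hq' w' hw'
  | @step i m ach s as h hf hsucc hfail hsat hrest ih =>
    obtain ⟨n, ih⟩ := ih
    refine ⟨((Γ i).acts h).length + n + 1, ?_⟩
    intro t b good X htb hcb p R hp hR l k hml hkc q hq w hw
    obtain ⟨k, rfl⟩ := hk hf hkc
    obtain ⟨p₁, p₂, rfl, hp₁, hp₂⟩ := List.map_eq_append_iff.1 hp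
    refine harc hf htb hcb p₁ p₂ R hp₁ hR n _ hq hw hsat ?_
    intro R' q' w' hR' hq' hw'
    rw [if_neg hsucc, if_neg hfail]
    refine ih t b good X htb hcb p₂ R' hp₂ hR' l _ hml ?_ q' hq' w' hw'
    rw [Finset.card_insert_of_notMem hf.2]
    omega
  | @retry i m ach s as hex hrest ih =>
    obtain ⟨n, ih⟩ := ih
    refine ⟨n + 1, ?_⟩
    intro t b good X htb hcb p R hp hR l k hml hkc q hq w hw
    obtain ⟨h, hf⟩ := hex
    obtain ⟨k, rfl⟩ := hk hf hkc
    have := hnet hrest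
    obtain ⟨l, rfl⟩ : ∃ l', l = l' + 1 := ⟨l - 1, by omega⟩
    rw [searchGraph, if_pos ⟨h, hf⟩, Option.isSome_or, Bool.or_eq_true]
    right
    exact ih t b good X htb hcb p R hp hR l _ (by omega) (by simp) q hq _ (hw.cons (Nat.zero_le b))

theorem exists_run_isSome [Fintype N] [DecidableEq N] [Fintype H] [Fintype K]
    (Ψ : TaskMotionDomain S A d) (mcost : Traj d → ℝ) (η : ℝ)
    (Γ : GraphNetwork Ψ.toTaskDomain N H K) {m : ℕ} {as : List A} (hs : Γ.ContainsPlan m as) :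
    ∃ n, ∀ (t b : ℕ) (good : (ℕ → Conf d) → Prop) (X : List ℕ → ℕ → Conf d), t ≤ b →
      Fintype.card (H ⊕ K) ≤ b → ∀ (p : List (A × Set (Conf d))) (R : Set (Conf d)),
      p.map Prod.fst = as → Robust Ψ η t good Ψ.s₀ R p → Ψ.q₀ ∈ R → ∀ l, m + 1 ≤ l →
      GoodFrom good X b n [] → (run Ψ Γ mcost η X l t).isSome := by
  obtain ⟨n, hn⟩ := exists_searchGraph_isSome Ψ mcost η Γ hs
  -- The bound `m + 1 ≤ l` makes `l` visibly positive, so that the first graph is searched.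
  refine ⟨n, fun t b good X htb hcb p R hp hR hq l hl hX => ?_⟩
  obtain ⟨l, rfl⟩ : ∃ l', l = l' + 1 := ⟨l - 1, by omega⟩
  exact hn t b good X htb hcb p R hp hR l _ (by omega) (by simp) _ hq _ hX

/-! ### Way points along a solution -/

/-- The `k`-th of the points that divide the trajectory `τ` into `m` pieces. -/
def wayPoint (τ : Traj d) (m k : ℕ) : Conf d :=
  τ (Set.projIcc 0 1 zero_le_one ((k : ℝ) / m))

theorem wayPoint_zero (τ : Traj d) (m : ℕ) : wayPoint τ m 0 = τ 0 := by
  unfold wayPoint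
  rw [Nat.cast_zero, zero_div, Set.projIcc_left]
  rfl

theorem wayPoint_self (τ : Traj d) {m : ℕ} (hm : 0 < m) : wayPoint τ m m = τ 1 := by
  unfold wayPoint
  rw [div_self (by positivity), Set.projIcc_right]
  rfl

theorem eventually_dist_wayPoint_le (τ : Traj d) {r : ℝ} (hr : 0 < r) :
    ∀ᶠ m : ℕ in atTop, ∀ k, dist (wayPoint τ m k) (wayPoint τ m (k + 1)) ≤ r := by
  obtain ⟨ε, hε, h⟩ := Metric.uniformContinuous_iff.1
    (CompactSpace.uniformContinuous_of_continuous τ.continuous) r hr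
  have hlim : ∀ᶠ m : ℕ in atTop, 1 / (m : ℝ) < ε :=
    tendsto_one_div_atTop_nhds_zero_nat.eventually (gt_mem_nhds hε)
  filter_upwards [hlim] with m hm k
  refine (h (lt_of_le_of_lt ?_ hm)).le
  rw [Subtype.dist_eq, Real.dist_eq]
  refine (Set.abs_projIcc_sub_projIcc _).trans (le_of_eq ?_)
  rw [← sub_div, abs_div, Nat.cast_succ]
  simp

/-- The samples visit, for each trajectory of the plan `p`, the neighborhoods of its way points. -/
def GoodSamples (C : Set (Conf d)) (r : ℝ) (m : ℕ) (p : TMPlan A d) (s : ℕ) (x : ℕ → Conf d) :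
    Prop :=
  ∀ aτ ∈ p, RRT.Visits
    (fun k => Metric.ball (wayPoint aτ.2 m (k + 1)) r ∩ interior C) m s x

/-- A plan with clearance is followed by RRT when the samples are good. -/
theorem robust_of_clearance (Ψ : TaskMotionDomain S A d) (hC : Convex ℝ Ψ.C) {η r δ : ℝ}
    (hr : 0 < r) (hrη : 3 * r ≤ η) (hrδ : 4 * r < δ) {m s t : ℕ} (hm : 0 < m) (hst : m * s ≤ t)
    {good : (ℕ → Conf d) → Prop} (p : TMPlan A d) :
    ∀ (s' : S) (c : Conf d), (∀ h : 0 < p.length, p[0].2 0 = c) →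
      (∀ (i : ℕ) (h : i + 1 < p.length), p[i + 1].2 0 = p[i].2 1) →
      (∀ (i : ℕ) (h : i < p.length),
        (∀ u : unitInterval, Metric.ball (p[i].2 u) δ ∩ Ψ.C ⊆ Ψ.free ∩ Ψ.ξ p[i].1) ∧
        Metric.ball (p[i].2 1) δ ∩ Ψ.C ⊆ Ψ.φ ((Ψ.startAt s' c).stateAt p (i + 1))) →
      (∀ aτ ∈ p, ∀ k, dist (wayPoint aτ.2 m k) (wayPoint aτ.2 m (k + 1)) ≤ r) →
      (∀ x, good x → GoodSamples Ψ.C r m p s x) →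
      Robust Ψ η t good s' (Metric.ball c r ∩ Ψ.C)
        (p.map fun aτ => (aτ.1, Metric.ball (aτ.2 1) r ∩ Ψ.C)) := by
  -- `good` is an arbitrary predicate implying `GoodSamples`, so it can keep referring to the whole
  -- plan while the induction passes to the tail.
  induction p with
  | nil => exact fun _ _ _ _ _ _ _ => trivial
  | cons aτ p ih =>
    obtain ⟨a, τ⟩ := aτ
    intro s' c hstart hglue hclear hstep hgood
    refine ⟨?_, ih (Ψ.γ s' a) (τ 1) (fun h => hglue 0 (Nat.succ_lt_succ h))
      (fun i h => hglue (i + 1) (Nat.succ_lt_succ h))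
      (fun i h => hclear (i + 1) (Nat.succ_lt_succ h))
      (fun aτ h => hstep aτ (List.mem_cons_of_mem _ h))
      (fun x hx aτ h => hgood x hx aτ (List.mem_cons_of_mem _ h))⟩
    rintro q ⟨hqc, hqC⟩ x hx
    have hc : τ 0 = c := hstart (Nat.succ_pos _)
    obtain ⟨hfree, hgoal⟩ := hclear 0 (Nat.succ_pos _)
    obtain ⟨v, hv, hvd⟩ := RRT.exists_mem_tree_of_visits (M := Ψ.motionDomain s' q a) hC hrη hrδ
      (c := wayPoint τ m) hst (fun k _ => hstep (a, τ) List.mem_cons_self k)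
      (fun k _ y hy => ⟨hy.2, (hfree _ hy).1.2, (hfree _ hy).2⟩) hr hqC
      (by rw [wayPoint_zero, hc]; exact hqc) (hgood x hx (a, τ) List.mem_cons_self)
    rw [wayPoint_self τ hm] at hvd
    have hvC : v.pt ∈ Ψ.C := (RRT.pt_mem_free hv).1
    obtain ⟨σ, hσ, hσ1⟩ := RRT.exists_mem_plans hv
      (hgoal ⟨Metric.mem_ball.2 (hvd.trans (by linarith)), hvC⟩)
    exact ⟨σ, hσ, by rw [hσ1]; exact ⟨hvd, hvC⟩⟩

/-! ### Probability estimates -/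

/-- A failure means that one of the `m` blocks misses its set entirely; by independence its `s`
samples do so with probability at most `ρ ^ s`. -/
theorem measure_not_visits_le {Ω : Type*} [MeasurableSpace Ω] {P : Measure Ω}
    {Y : ℕ → Ω → Conf d} (hY : iIndepFun Y P) {U : ℕ → Set (Conf d)}
    (hU : ∀ k, MeasurableSet (U k)) {ρ : ENNReal} {m : ℕ}
    (hρ : ∀ k < m, ∀ n, P (Y n ⁻¹' (U k)ᶜ) ≤ ρ) (s : ℕ) :
    P {ω | ¬ RRT.Visits U m s (fun n => Y n ω)} ≤ m * ρ ^ s := by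
  have hsub : {ω | ¬ RRT.Visits U m s (fun n => Y n ω)} ⊆
      ⋃ k ∈ Finset.range m, ⋂ i ∈ Finset.Ico (k * s) ((k + 1) * s), Y i ⁻¹' (U k)ᶜ := by
    intro ω hω
    simp only [RRT.Visits, Set.mem_ofPred_eq, not_forall, not_exists, not_and] at hω
    obtain ⟨k, hk, hω⟩ := hω
    exact Set.mem_biUnion (Finset.mem_coe.2 (Finset.mem_range.2 hk)) (Set.mem_iInter₂.2 hω)
  refine (measure_mono hsub).trans ((measure_biUnion_finset_le _ _).trans ?_)
  refine (Finset.sum_le_card_nsmul _ _ (ρ ^ s) ?_).trans (by simp)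
  intro k hk
  rw [hY.measure_inter_preimage_eq_mul _ (fun i _ => (hU k).compl)]
  refine (Finset.prod_le_pow_card _ _ ρ fun i _ => hρ k (Finset.mem_range.1 hk) i).trans ?_
  rw [Nat.card_Ico, ← Nat.sub_mul]
  simp

theorem cond_compl_ball_inter_interior_lt_one {C : Set (Conf d)} (hconv : Convex ℝ C)
    (hbdd : Bornology.IsBounded C) (hint : (interior C).Nonempty) {c : Conf d} (hc : c ∈ C) {r : ℝ}
    (hr : 0 < r) : volume[|C] (Metric.ball c r ∩ interior C)ᶜ < 1 := by
  have hCtop : volume C ≠ ⊤ := hbdd.measure_lt_top.ne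
  have hC0 : volume C ≠ 0 := (Measure.measure_pos_of_nonempty_interior _ hint).ne'
  have : IsProbabilityMeasure (volume[|C]) := cond_isProbabilityMeasure_of_finite hC0 hCtop
  have hopen : IsOpen (Metric.ball c r ∩ interior C) := Metric.isOpen_ball.inter isOpen_interior
  have hne : (Metric.ball c r ∩ interior C).Nonempty := by
    -- A way point may lie on the boundary of `C`, but a convex set with nonempty interior lies in
    -- the closure of its interior, so the open set in question is nonempty and has positive volume.
    have hcl : c ∈ closure (interior C) := by
      rw [hconv.closure_interior_eq_closure_of_nonempty_interior hint]
      exact subset_closure hc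
    exact mem_closure_iff.1 hcl _ Metric.isOpen_ball (Metric.mem_ball_self hr)
  rw [prob_compl_eq_one_sub hopen.measurableSet]
  refine ENNReal.sub_lt_self ENNReal.one_ne_top one_ne_zero ?_
  rw [cond_apply' hopen.measurableSet]
  refine mul_ne_zero (ENNReal.inv_ne_zero.2 hCtop) ?_
  rw [Set.inter_eq_right.2 (Set.inter_subset_right.trans interior_subset)]
  exact (hopen.measure_pos volume hne).ne'

/-- Finitely many numbers below `1` have a common bound below `1`; it is found by letting `ρ` tend
to `1` from the left. -/
theorem exists_cond_compl_le {C : Set (Conf d)} (hconv : Convex ℝ C)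
    (hbdd : Bornology.IsBounded C) (hint : (interior C).Nonempty) {r : ℝ} (hr : 0 < r) (m : ℕ)
    (p : TMPlan A d) (hp : ∀ aτ ∈ p, ∀ u, aτ.2 u ∈ C) :
    ∃ ρ < (1 : ENNReal), ∀ aτ ∈ p, ∀ k < m,
      volume[|C] (Metric.ball (wayPoint aτ.2 m (k + 1)) r ∩ interior C)ᶜ ≤ ρ := by
  have hev : ∀ᶠ ρ : ENNReal in 𝓝[<] 1, ∀ aτ ∈ p, ∀ k < m,
      volume[|C] (Metric.ball (wayPoint aτ.2 m (k + 1)) r ∩ interior C)ᶜ ≤ ρ := by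
    refine (eventually_all_finite (List.finite_toSet p)).2 fun aτ haτ =>
      (eventually_all_finite (Set.finite_lt_nat m)).2 fun k _ => ?_
    filter_upwards [Ioo_mem_nhdsLT (cond_compl_ball_inter_interior_lt_one hconv hbdd hint
      (hp aτ haτ _) hr)] with ρ hρ using hρ.1.le
  have : (𝓝[<] (1 : ENNReal)).NeBot := nhdsLT_neBot_of_exists_lt ⟨0, one_pos⟩
  obtain ⟨ρ, hρ, hlt⟩ := (hev.and self_mem_nhdsWithin).exists
  exact ⟨ρ, hlt, hρ⟩

/-- Bad samples are exponentially unlikely. -/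
theorem measure_not_goodSamples_le {C : Set (Conf d)} {r : ℝ} {m : ℕ} {p : TMPlan A d}
    {ρ : ENNReal} (hρ : ∀ aτ ∈ p, ∀ k < m,
      volume[|C] (Metric.ball (wayPoint aτ.2 m (k + 1)) r ∩ interior C)ᶜ ≤ ρ)
    {Ω : Type*} [MeasurableSpace Ω] {P : Measure Ω} {Y : ℕ → Ω → Conf d}
    (hY : ∀ n, Measurable (Y n)) (hindep : iIndepFun Y P)
    (hunif : ∀ n, P.map (Y n) = volume[|C]) (s : ℕ) :
    P {ω | ¬ GoodSamples C r m p s (fun n => Y n ω)} ≤ (p.length * m : ℕ) * ρ ^ s := by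
  classical
  have hsub : {ω | ¬ GoodSamples C r m p s (fun n => Y n ω)} ⊆
      ⋃ aτ ∈ p.toFinset, {ω | ¬ RRT.Visits
        (fun k => Metric.ball (wayPoint aτ.2 m (k + 1)) r ∩ interior C) m s
        (fun n => Y n ω)} := by
    intro ω hω
    simp only [GoodSamples, Set.mem_ofPred_eq, not_forall] at hω
    obtain ⟨aτ, haτ, hω⟩ := hω
    exact Set.mem_biUnion (Finset.mem_coe.2 (List.mem_toFinset.2 haτ)) hω
  refine (measure_mono hsub).trans ((measure_biUnion_finset_le _ _).trans ?_)
  have hU : ∀ c : Conf d, MeasurableSet (Metric.ball c r ∩ interior C) := fun c =>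
    (Metric.isOpen_ball.inter isOpen_interior).measurableSet
  refine (Finset.sum_le_card_nsmul _ _ (m * ρ ^ s) ?_).trans ?_
  · intro aτ haτ
    refine measure_not_visits_le hindep (fun k => hU _) (fun k hk n => ?_) s
    rw [← Measure.map_apply (hY n) (hU _).compl, hunif n]
    exact hρ aτ (List.mem_toFinset.1 haτ) k hk
  · rw [nsmul_eq_mul, ← mul_assoc, Nat.cast_mul]
    gcongr
    exact List.toFinset_card_le p

/-- The words of length at most `n` with letters at most `b`. -/
def words (n b : ℕ) : Finset (List ℕ) :=
  (Finset.range (n + 1)).biUnion fun k =>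
    Finset.univ.image fun f : Fin k → Fin (b + 1) => List.ofFn fun i => (f i : ℕ)

theorem mem_words {n b : ℕ} {u : List ℕ} (hu : u.length ≤ n) (hub : ∀ j ∈ u, j ≤ b) :
    u ∈ words n b := by
  refine Finset.mem_biUnion.2 ⟨u.length, Finset.mem_range.2 (by omega), Finset.mem_image.2
    ⟨fun i => ⟨u[i], Nat.lt_succ_of_le (hub _ (List.getElem_mem _))⟩, Finset.mem_univ _, ?_⟩⟩
  simp

theorem card_words_le (n b : ℕ) : (words n b).card ≤ (n + 1) * (b + 1) ^ n := by
  refine Finset.card_biUnion_le.trans ((Finset.sum_le_card_nsmul _ _ ((b + 1) ^ n) ?_).trans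
    (by simp))
  intro k hk
  refine Finset.card_image_le.trans ?_
  simp only [Finset.card_univ, Fintype.card_fun, Fintype.card_fin]
  exact Nat.pow_le_pow_right (Nat.succ_pos b) (by simpa [Nat.lt_succ_iff] using hk)

/-- With `s = t / m`, the polynomial factor is at most a constant times `s ^ n` once `t ≥ m`, and `s
^ n * ρ ^ s` tends to `0`. -/
theorem tendsto_poly_mul_pow_div {ρ : ENNReal} (hρ : ρ < 1) (n B : ℕ) {m : ℕ} (hm : 0 < m) :
    Tendsto (fun t : ℕ => ((t + B + 1 : ℕ) : ENNReal) ^ n * ρ ^ (t / m)) atTop (𝓝 0) := by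
  lift ρ to NNReal using (hρ.trans ENNReal.one_lt_top).ne
  have hρ1 : ρ < 1 := by exact_mod_cast hρ
  suffices h : Tendsto (fun t : ℕ => ((t + B + 1 : ℕ) : NNReal) ^ n * ρ ^ (t / m)) atTop (𝓝 0) by
    simpa only [ENNReal.coe_mul, ENNReal.coe_pow, ENNReal.coe_natCast, ENNReal.coe_zero]
      using ENNReal.tendsto_coe.2 h
  rw [← NNReal.tendsto_coe]
  have hgeo : Tendsto (fun s : ℕ => ((2 * (m + B + 1) : ℝ)) ^ n * ((s : ℝ) ^ n * (ρ : ℝ) ^ s))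
      atTop (𝓝 0) := by
    simpa using (tendsto_pow_const_mul_const_pow_of_abs_lt_one n
      (r := (ρ : ℝ)) (by rw [NNReal.abs_eq]; exact_mod_cast hρ1)).const_mul
        (((2 * (m + B + 1) : ℝ)) ^ n)
  refine squeeze_zero' (Eventually.of_forall fun t => NNReal.coe_nonneg _) ?_
    (hgeo.comp (Nat.tendsto_div_const_atTop hm.ne'))
  filter_upwards [eventually_ge_atTop m] with t ht
  have hs : 1 ≤ t / m := (Nat.one_le_div_iff hm).2 ht
  have hle : t + B + 1 ≤ 2 * (m + B + 1) * (t / m) := by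
    have h1 := Nat.div_add_mod t m
    have h2 := Nat.mod_lt t hm
    nlinarith
  simp only [Function.comp_apply, NNReal.coe_mul, NNReal.coe_pow, NNReal.coe_natCast]
  rw [← mul_assoc, ← mul_pow]
  gcongr
  exact_mod_cast hle

/-- A union bound over all words that the search could possibly use, instead of the random ones that
it does use. -/
theorem measure_not_goodFrom_le {Ω : Type*} [MeasurableSpace Ω] {P : Measure Ω}
    {X : List ℕ → ℕ → Ω → Conf d} {good : (ℕ → Conf d) → Prop} {ε : ENNReal}
    (h : ∀ w, P {ω | ¬ good (fun n => X w n ω)} ≤ ε) (b n : ℕ) :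
    P {ω | ¬ GoodFrom good (fun w n => X w n ω) b n []} ≤ ((n + 1) * (b + 1) ^ n : ℕ) * ε := by
  have hsub : {ω | ¬ GoodFrom good (fun w n => X w n ω) b n []} ⊆
      ⋃ u ∈ words n b, {ω | ¬ good (fun n => X u n ω)} := by
    intro ω hω
    simp only [GoodFrom, Set.mem_ofPred_eq, not_forall, List.append_nil] at hω
    obtain ⟨u, hu, hub, hω⟩ := hω
    exact Set.mem_biUnion (Finset.mem_coe.2 (mem_words hu hub)) hω
  refine (measure_mono hsub).trans ((measure_biUnion_finset_le _ _).trans ?_)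
  refine (Finset.sum_le_card_nsmul _ _ ε fun u _ => h u).trans ?_
  rw [nsmul_eq_mul]
  gcongr
  exact card_words_le n b

end TMPIDAN

end

/-! ### Choice of constants and passage to the limit -/

theorem mainTheorem1 {S A N H K : Type*} {d : ℕ} [Fintype N] [DecidableEq N] [Fintype H] [Fintype K]
    (Ψ : TaskMotionDomain S A d) (Γ : GraphNetwork Ψ.toTaskDomain N H K)
    (hconv : Convex ℝ Ψ.C) (hbdd : Bornology.IsBounded Ψ.C) (hint : (interior Ψ.C).Nonempty)
    (mcost : Traj d → ℝ) (η : ℝ) (hη : 0 < η)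
    {Ω : Type*} [MeasurableSpace Ω] (P : Measure Ω) [IsProbabilityMeasure P]
    (X : List ℕ → ℕ → Ω → Conf d)
    (hmeas : ∀ w n, Measurable (X w n))
    (hindep : iIndepFun (fun k : List ℕ × ℕ => X k.1 k.2) P)
    (hunif : ∀ w n, P.map (X w n) = volume[|Ψ.C])
    (hsol : ∃ (l : ℕ) (p : TMPlan A d),
      Γ.ContainsPlan l (p.map Prod.fst) ∧ Ψ.IsSolution p ∧ Ψ.HasClearance p) :
    Tendsto (fun k : ℕ × ℕ =>
        P {ω | TMPIDAN.Finds Ψ Γ mcost η (fun w n => X w n ω) k.1 k.2})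
      (atTop ×ˢ atTop) (𝓝 1) ∧
    Tendsto (fun k : ℕ × ℕ =>
        P {ω | ¬ TMPIDAN.Finds Ψ Γ mcost η (fun w n => X w n ω) k.1 k.2})
      (atTop ×ˢ atTop) (𝓝 0) := by
  obtain ⟨l₀, p, hplan, hp, δ, hδ, hclear⟩ := hsol
  have hlen : 0 < p.length := List.length_pos_iff.2 hp.ne_nil
  have hfree : ∀ aτ ∈ p, ∀ u, aτ.2 u ∈ Ψ.C := by
    intro aτ haτ u
    obtain ⟨i, hi, rfl⟩ := List.mem_iff_getElem.1 haτ
    exact (hp.free i hi u).1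
  obtain ⟨r, hr, hrη, hrδ⟩ : ∃ r : ℝ, 0 < r ∧ 3 * r ≤ η ∧ 4 * r < δ := by
    refine ⟨min (η / 3) (δ / 5), by positivity, ?_, ?_⟩
    · linarith [min_le_left (η / 3) (δ / 5)]
    · linarith [min_le_right (η / 3) (δ / 5)]
  have hev : ∀ᶠ m : ℕ in atTop, ∀ aτ ∈ p, ∀ k,
      dist (TMPIDAN.wayPoint aτ.2 m k) (TMPIDAN.wayPoint aτ.2 m (k + 1)) ≤ r :=
    (eventually_all_finite (List.finite_toSet p)).2 fun aτ _ =>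
      TMPIDAN.eventually_dist_wayPoint_le aτ.2 hr
  obtain ⟨m, hstep, hm⟩ := (hev.and (eventually_gt_atTop 0)).exists
  have hq₀ : Ψ.q₀ ∈ Ψ.φ Ψ.s₀ := hp.start hlen ▸ hp.source 0 hlen
  have hq₀C : Ψ.q₀ ∈ Ψ.C := hp.start hlen ▸ (hp.free 0 hlen 0).1
  obtain ⟨ρ, hρ, hbad⟩ :=
    TMPIDAN.exists_cond_compl_le hconv hbdd hint hr m p hfree
  obtain ⟨n, hn⟩ := TMPIDAN.exists_run_isSome Ψ mcost η Γ hplan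
  set B := Fintype.card (H ⊕ K) with hB
  set g : ℕ → ENNReal := fun t =>
    ((n + 1) * (p.length * m) : ℕ) * (((t + B + 1 : ℕ) : ENNReal) ^ n * ρ ^ (t / m)) with hg
  have hglim : Tendsto g atTop (𝓝 0) := by
    simpa only [mul_zero] using ENNReal.Tendsto.const_mul (TMPIDAN.tendsto_poly_mul_pow_div hρ n B hm)
      (Or.inr (ENNReal.natCast_ne_top ((n + 1) * (p.length * m))))
  have hle : ∀ l t, l₀ + 1 ≤ l →
      P {ω | ¬ TMPIDAN.Finds Ψ Γ mcost η (fun w n => X w n ω) l t} ≤ g t := by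
    intro l t hl
    have hrob := TMPIDAN.robust_of_clearance Ψ hconv hr hrη hrδ hm (Nat.mul_div_le t m)
      (good := TMPIDAN.GoodSamples Ψ.C r m p (t / m)) p Ψ.s₀ Ψ.q₀ hp.start hp.glue hclear hstep
      (fun _ hx => hx)
    have hsub : {ω | ¬ TMPIDAN.Finds Ψ Γ mcost η (fun w n => X w n ω) l t} ⊆
        {ω | ¬ TMPIDAN.GoodFrom (TMPIDAN.GoodSamples Ψ.C r m p (t / m)) (fun w n => X w n ω)
          (t + B) n []} := by
      intro ω hω hgood
      -- The letter bound `t + B` covers both positions of motion plans (at most `t`) and choices of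
      -- arcs (at most `B`).
      obtain ⟨p', hp'⟩ := Option.isSome_iff_exists.1 <| hn t (t + B) _ (fun w n => X w n ω)
        (Nat.le_add_right _ _) (Nat.le_add_left _ _) _ _ (by simp) hrob
        ⟨Metric.mem_ball_self hr, hq₀C⟩ l hl hgood
      exact hω ⟨p', hp', TMPIDAN.run_sound Ψ Γ mcost η _ l t hq₀ hp'⟩
    refine (measure_mono hsub).trans ((TMPIDAN.measure_not_goodFrom_le (fun w =>
      TMPIDAN.measure_not_goodSamples_le hbad (hmeas w) (hindep.precomp (g := fun k => (w, k)) (Prod.mk_right_injective w))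
        (hunif w) (t / m)) (t + B) n).trans (le_of_eq ?_))
    rw [hg]
    push_cast
    ring
  have hevl : ∀ᶠ k : ℕ × ℕ in atTop ×ˢ atTop,
      P {ω | ¬ TMPIDAN.Finds Ψ Γ mcost η (fun w n => X w n ω) k.1 k.2} ≤ g k.2 :=
    (tendsto_fst.eventually (eventually_ge_atTop (l₀ + 1))).mono fun k hk => hle k.1 k.2 hk
  have hlim₀ : Tendsto (fun k : ℕ × ℕ =>
      P {ω | ¬ TMPIDAN.Finds Ψ Γ mcost η (fun w n => X w n ω) k.1 k.2}) (atTop ×ˢ atTop) (𝓝 0) :=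
    tendsto_of_tendsto_of_tendsto_of_le_of_le' tendsto_const_nhds (hglim.comp tendsto_snd)
      (Eventually.of_forall fun _ => zero_le) hevl
  refine ⟨?_, hlim₀⟩
  have hsub : Tendsto (fun k : ℕ × ℕ => 1 -
      P {ω | ¬ TMPIDAN.Finds Ψ Γ mcost η (fun w n => X w n ω) k.1 k.2}) (atTop ×ˢ atTop) (𝓝 1) := by
    simpa using ENNReal.Tendsto.sub tendsto_const_nhds hlim₀ (Or.inl ENNReal.one_ne_top)
  refine tendsto_of_tendsto_of_tendsto_of_le_of_le hsub tendsto_const_nhds (fun k => ?_)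
    fun k => prob_le_one
  -- The event need not be measurable, so the complement rule is replaced by subadditivity of the
  -- outer measure.
  refine tsub_le_iff_right.2 ?_
  rw [← measure_univ (μ := P),
    ← Set.union_compl_self {ω | TMPIDAN.Finds Ψ Γ mcost η (fun w n => X w n ω) k.1 k.2}]
  exact measure_union_le _ _
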